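/- A $(0,1)$-matrix is \emph{simple} if it has no repeated columns. A $(0,1)$-matrix $F$ is a \emph{configuration} in a $(0,1)$-matrix $A$ if some submatrix of $A$ is a row and column permutation of $F$. Let $\mathrm{forb}(m,F)$ be the maximum number of columns of a simple $m$-rowed $(0,1)$-matrix that does not have $F$ as a configuration. Let $F(0,7,1,0)$ be the $2\times 8$ matrix with seven columns $\binom{1}{0}$ and one column $\binom{0}{1}$. Then for every integer $m\ge 0$, $$\mathrm{forb}(m,F(0,7,1,0))\le\Bigl\lfloor\tfrac{24}{5}m\Bigr\rfloor+1,$$ with equality whenever $m\equiv 0\pmod 5$. Moreover, equality for $m=5t$ is attained by the following matrix. Let $K_5^s$ be the $5\times\binom5s$ matrix of all $(0,1)$-columns of sum $s$, and let $B$ be the $5\times 24$ matrix obtained by deleting the column of $1$'s from the $5\times 25$ matrix $$\left[K_5^0\;K_5^1\;\begin{array}{ccccccccccccc} 1&1&1&1&0&0&0&0&0&1&1&0&0\\ 1&0&0&0&1&1&1&0&0&1&0&1&0\\ 0&1&0&0&1&0&0&1&1&1&0&0&1\\ 0&0&1&0&0&1&0&1&0&0&1&1&1\\ 0&0&0&1&0&0&1&0&1&0&1&1&1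 \end{array}\;K_5^4\;K_5^5\right].$$ Then the $5t\times(24t+1)$ matrix consisting of $t$ diagonal blocks equal to $B$, all entries $1$ in the blocks above the diagonal, all entries $0$ in the blocks below the diagonal, and one additional column of $1$'s, is simple, does not have $F(0,7,1,0)$ as a configuration, and has exactly $\mathrm{forb}(5t,F(0,7,1,0))$ columns. -/

import Mathlib

namespace ForbConfig

/-- A (0,1)-matrix with rows indexed by `ι` and columns indexed by `κ`. -/
abbrev Mat01 (ι κ : Type*) := Matrix ι κ (Fin 2)

/-- `A` is simple: no repeated columns. -/
def IsSimple {ι κ : Type*} (A : Mat01 ι κ) : Prop :=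
  ∀ c d : κ, (∀ i, A i c = A i d) → c = d

/-- `F ≺ A`: `F` is a configuration in `A`, that is, some submatrix of `A` (on distinct rows
and distinct columns) is a row and column permutation of `F`. -/
def IsConfig {α β ι κ : Type*} (F : Mat01 α β) (A : Mat01 ι κ) : Prop :=
  ∃ (r : α ↪ ι) (c : β ↪ κ), A.submatrix r c = F

/-- `A` is simple and has no configuration `F`, i.e. `A ∈ Avoid(m, F)`, where `m` is the number
of rows of `A`. -/
def Avoids {α β ι κ : Type*} (F : Mat01 α β) (A : Mat01 ι κ) : Prop :=
  IsSimple A ∧ ¬ IsConfig F A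

/-- `forb(m, F)`: the maximum number of columns of an `m`-rowed matrix in `Avoid(m, F)`
(see `isGreatest_forb` for the fact that it is a maximum). -/
noncomputable def forb {α β : Type*} (m : ℕ) (F : Mat01 α β) : ℕ :=
  sSup {n : ℕ | ∃ A : Mat01 (Fin m) (Fin n), Avoids F A}

theorem isGreatest_forb {α β : Type*} [Nonempty β] (m : ℕ) (F : Mat01 α β) :
    IsGreatest {n : ℕ | ∃ A : Mat01 (Fin m) (Fin n), Avoids F A} (forb m F) := by
  have hne : {n : ℕ | ∃ A : Mat01 (Fin m) (Fin n), Avoids F A}.Nonempty := by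
    refine ⟨0, fun _ c => c.elim0, fun c => c.elim0, ?_⟩
    rintro ⟨_, c, _⟩
    exact (c (Classical.arbitrary β)).elim0
  have hbd : BddAbove {n : ℕ | ∃ A : Mat01 (Fin m) (Fin n), Avoids F A} := by
    refine ⟨2 ^ m, ?_⟩
    rintro n ⟨A, hA, _⟩
    have hinj : Function.Injective (fun (c : Fin n) (i : Fin m) => A i c) :=
      fun c d h => hA c d (fun i => congrFun h i)
    simpa using Fintype.card_le_of_injective _ hinj
  exact ⟨Nat.sSup_mem hne hbd, fun n hn => le_csSup hbd hn⟩

/-- `A ∈ Ext(m, F)`, where `m` is the number of rows of `A`: `A` lies in `Avoid(m, F)` and has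
exactly `forb(m, F)` columns. -/
def IsExtremal {α β ι κ : Type*} [Fintype ι] [Fintype κ] (F : Mat01 α β) (A : Mat01 ι κ) : Prop :=
  Avoids F A ∧ Fintype.card κ = forb (Fintype.card ι) F

/-- `F(0,p,1,0)`: the `2 × (p+1)` matrix with `p` columns `(1,0)ᵀ` followed by one column
`(0,1)ᵀ`. -/
def F0p10 (p : ℕ) : Mat01 (Fin 2) (Fin (p + 1)) :=
  Matrix.of ![fun c => if c = Fin.last p then 0 else 1,
              fun c => if c = Fin.last p then 1 else 0]

/-- The explicit `5 × 25` matrix `[K₅⁰ K₅¹ T K₅⁴ K₅⁵]`, where `K₅ˢ` consists of the columns of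
sum `s` and `T` is a `5 × 13` matrix. The last column is the column of 1's. -/
def M25 : Mat01 (Fin 5) (Fin 25) :=
  !![0, 1,0,0,0,0, 1,1,1,1,0,0,0,0,0,1,1,0,0, 0,1,1,1,1, 1;
     0, 0,1,0,0,0, 1,0,0,0,1,1,1,0,0,1,0,1,0, 1,0,1,1,1, 1;
     0, 0,0,1,0,0, 0,1,0,0,1,0,0,1,1,1,0,0,1, 1,1,0,1,1, 1;
     0, 0,0,0,1,0, 0,0,1,0,0,1,0,1,0,0,1,1,1, 1,1,1,0,1, 1;
     0, 0,0,0,0,1, 0,0,0,1,0,0,1,0,1,0,1,1,1, 1,1,1,1,0, 1]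

/-- `M25` with its (last) column of 1's removed. -/
def B24 : Mat01 (Fin 5) (Fin 24) := M25.submatrix id Fin.castSucc

/-- The block construction with `t` diagonal blocks equal to `B`, all 1's above the diagonal
blocks, all 0's below them, and one final column of 1's. Row `(i, r)` is row `r` of the `i`-th
row block; column `inl (j, c)` is column `c` of the `j`-th column block. -/
def blockConstruction {ρ κ : Type*} (t : ℕ) (B : Mat01 ρ κ) :
    Mat01 (Fin t × ρ) ((Fin t × κ) ⊕ Unit) :=
  fun x y => match y with
    | Sum.inl z => if x.1 < z.1 then 1 else if x.1 = z.1 then B x.2 z.2 else 0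
    | Sum.inr _ => 1

end ForbConfig

open Finset

/-! Read columns as sets of rows. Avoidance says that if some set contains `y` but not `x`, then at
most 6 contain `x` but not `y`; hence also the degree of `x` exceeds that of `y` by at most 5. With
`∅` and the full set removed, the target is `5 * #𝓐 + 5 ≤ 24 * #S` (`card_bound`), by induction on
the ground set, sorted by degree.

If no set crosses some cut of the order (contains an earlier element and misses a later one), every
set is comparable with the upper part `S₂`. The family splits into sets inside `S₂`, sets around
`S₂`, and perhaps `S₂` itself, and the two inductive bounds add up exactly.

Otherwise every cut is crossed, so consecutive degrees differ by at most 5, and five steps gain at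
most 24 (`degree_add_five_le`). If the total range is at most 12, every pair is separated at most 12
times and double counting suffices (`card_bound_of_diffCount_add_le`). If it is larger, the sets
containing the element of least degree and those missing the element of greatest degree live on
disjoint ends of the order. Each end has degrees at most 6, hence few sets, and the degree growth in
between accounts for the rest.

Equality comes from stacking `B24` in blocks: rows of different blocks are nested, so only pairs
within one block matter. -/

namespace ForbConfig

/-! ### Separation counts and incidence bounds for set families -/

section Families

variable {α : Type*} [DecidableEq α]

/-- The number of members of `𝓐` that contain `x` but not `y`. -/
def diffCount (𝓐 : Finset (Finset α)) (x y : α) : ℕ := #{U ∈ 𝓐 | x ∈ U ∧ y ∉ U}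

/-- The number of members of `𝓐` that contain `x`. -/
def familyDegree (𝓐 : Finset (Finset α)) (x : α) : ℕ := #{U ∈ 𝓐 | x ∈ U}

theorem familyDegree_add_diffCount (𝓐 : Finset (Finset α)) (x y : α) :
    familyDegree 𝓐 y + diffCount 𝓐 x y = familyDegree 𝓐 x + diffCount 𝓐 y x := by
  have key (x y : α) :
      familyDegree 𝓐 x = #{U ∈ 𝓐 | x ∈ U ∧ y ∈ U} + diffCount 𝓐 x y := by
    unfold familyDegree diffCount
    rw [← card_filter_add_card_filter_not (s := {U ∈ 𝓐 | x ∈ U}) (fun U => y ∈ U),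
      filter_filter, filter_filter]
  have hc : #{U ∈ 𝓐 | x ∈ U ∧ y ∈ U} = #{U ∈ 𝓐 | y ∈ U ∧ x ∈ U} := by
    simp only [and_comm]
  have h1 := key x y
  have h2 := key y x
  omega

theorem diffCount_pos {𝓐 : Finset (Finset α)} {x y : α} {U : Finset α} (hU : U ∈ 𝓐)
    (hx : x ∈ U) (hy : y ∉ U) : 0 < diffCount 𝓐 x y :=
  card_pos.2 ⟨U, by simp [hU, hx, hy]⟩

theorem exists_of_diffCount_pos {𝓐 : Finset (Finset α)} {x y : α}
    (h : 0 < diffCount 𝓐 x y) : ∃ U ∈ 𝓐, x ∈ U ∧ y ∉ U := by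
  obtain ⟨U, hU⟩ := card_pos.1 h
  exact ⟨U, by simpa using hU⟩

theorem diffCount_mono {𝓐 𝓑 : Finset (Finset α)} (h : 𝓐 ⊆ 𝓑) (x y : α) :
    diffCount 𝓐 x y ≤ diffCount 𝓑 x y :=
  card_le_card (filter_subset_filter _ h)

/-- Whenever some member separates `y` from `x`, at most `6` members separate `x` from `y`. -/
def SeparatesFew (𝓐 : Finset (Finset α)) : Prop :=
  ∀ x y, 0 < diffCount 𝓐 y x → diffCount 𝓐 x y ≤ 6

theorem SeparatesFew.mono {𝓐 𝓑 : Finset (Finset α)} (h : 𝓐 ⊆ 𝓑) (hB : SeparatesFew 𝓑) :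
    SeparatesFew 𝓐 := fun x y hxy =>
  (diffCount_mono h x y).trans (hB x y (hxy.trans_le (diffCount_mono h y x)))

/-- Counting incidences with a family of nonempty sets whose elements have degree at most `6`. -/
theorem two_mul_card_le_of_degree_le {𝓒 : Finset (Finset α)} {T : Finset α}
    (hT : ∀ U ∈ 𝓒, U ⊆ T) (hne : ∅ ∉ 𝓒) (hdeg : ∀ x ∈ T, #{U ∈ 𝓒 | x ∈ U} ≤ 6) :
    2 * #𝓒 ≤ 7 * #T := by
  have h1 : ∑ U ∈ 𝓒, #U = ∑ x ∈ T, #{U ∈ 𝓒 | x ∈ U} := by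
    have := sum_card_bipartiteAbove_eq_sum_card_bipartiteBelow (s := 𝓒) (t := T)
      (fun (U : Finset α) x => x ∈ U)
    simp only [bipartiteAbove, bipartiteBelow] at this
    rw [← this]
    refine sum_congr rfl fun U hU => ?_
    congr 1
    ext x
    simpa using fun hx => hT U hU hx
  have h2 : ∑ x ∈ T, #{U ∈ 𝓒 | x ∈ U} ≤ #T * 6 := by
    simpa using sum_le_card_nsmul T _ 6 hdeg
  have h3 : #{U ∈ 𝓒 | #U = 1} ≤ #T := by
    have : {U ∈ 𝓒 | #U = 1} ⊆ T.powersetCard 1 := by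
      intro U hU
      rw [mem_filter] at hU
      exact mem_powersetCard.2 ⟨hT U hU.1, hU.2⟩
    simpa using card_le_card this
  have h4 : 2 * #𝓒 ≤ ∑ U ∈ 𝓒, #U + #{U ∈ 𝓒 | #U = 1} := by
    rw [card_filter, ← sum_add_distrib, mul_comm, ← smul_eq_mul]
    refine card_nsmul_le_sum _ _ _ fun U hU => ?_
    have : U ≠ ∅ := fun h => hne (h ▸ hU)
    have := card_pos.2 (nonempty_iff_ne_empty.2 this)
    split_ifs <;> omega
  omega

theorem card_add_one_le_two_pow {𝓒 : Finset (Finset α)} {T : Finset α}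
    (hT : ∀ U ∈ 𝓒, U ⊆ T) (hne : ∅ ∉ 𝓒) : #𝓒 + 1 ≤ 2 ^ #T := by
  rw [← card_insert_of_notMem hne, ← card_powerset]
  refine card_le_card fun U hU => ?_
  rcases mem_insert.1 hU with rfl | h
  · simp
  · exact mem_powerset.2 (hT U h)

/-- The incidence bound suffices from three points on; for one or two points the power-set bound is
needed, and it is tight at one point. -/
theorem five_mul_card_le_of_degree_le {𝓒 : Finset (Finset α)} {T : Finset α}
    (hT : ∀ U ∈ 𝓒, U ⊆ T) (hne : ∅ ∉ 𝓒) (hdeg : ∀ x ∈ T, #{U ∈ 𝓒 | x ∈ U} ≤ 6)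
    (h0 : 0 < #T) : 5 * #𝓒 + 19 ≤ 24 * #T := by
  have h1 := two_mul_card_le_of_degree_le hT hne hdeg
  have h2 := card_add_one_le_two_pow hT hne
  by_cases h : #T < 3
  · generalize #T = t at *
    interval_cases t <;> omega
  · omega

/-- Counting the pairs that are separated by members of a family. -/
theorem card_bound_of_diffCount_add_le {𝓐 : Finset (Finset α)} {S : Finset α}
    (hS : ∀ U ∈ 𝓐, U ⊆ S) (h0 : ∅ ∉ 𝓐) (h1 : S ∉ 𝓐) (hn : 5 ≤ #S)
    (hd : ∀ x ∈ S, ∀ y ∈ S, diffCount 𝓐 x y + diffCount 𝓐 y x ≤ 12) :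
    5 * #𝓐 + 5 ≤ 24 * #S := by
  set n := #S with hn'
  have hcount : ∑ U ∈ 𝓐, #U * (n - #U) = ∑ p ∈ S.offDiag, diffCount 𝓐 p.1 p.2 := by
    have := sum_card_bipartiteAbove_eq_sum_card_bipartiteBelow (s := 𝓐) (t := S.offDiag)
      (fun (U : Finset α) p => p.1 ∈ U ∧ p.2 ∉ U)
    simp only [bipartiteAbove, bipartiteBelow] at this
    unfold diffCount
    rw [← this]
    refine sum_congr rfl fun U hU => ?_
    rw [hn', ← card_sdiff_of_subset (hS U hU), ← card_product]
    congr 1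
    ext ⟨x, y⟩
    simp only [mem_product, mem_sdiff, mem_filter, mem_offDiag]
    constructor
    · rintro ⟨hx, hy, hyU⟩
      exact ⟨⟨hS U hU hx, hy, fun h => hyU (h ▸ hx)⟩, hx, hyU⟩
    · rintro ⟨⟨_, hy, _⟩, hx, hyU⟩
      exact ⟨hx, hy, hyU⟩
  have hswap : ∑ p ∈ S.offDiag, diffCount 𝓐 p.1 p.2 = ∑ p ∈ S.offDiag, diffCount 𝓐 p.2 p.1 := by
    refine sum_nbij' Prod.swap Prod.swap ?_ ?_ ?_ ?_ ?_ <;> simp +contextual [eq_comm]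
  have hsum : 2 * ∑ p ∈ S.offDiag, diffCount 𝓐 p.1 p.2 ≤ (n * n - n) * 12 := by
    rw [two_mul]
    nth_rewrite 2 [hswap]
    rw [← sum_add_distrib, hn', ← offDiag_card]
    exact sum_le_card_nsmul S.offDiag _ 12 fun p hp => by
      rw [mem_offDiag] at hp
      exact hd _ hp.1 _ hp.2.1
  have hsmall (k : ℕ) : #{U ∈ 𝓐 | #U = k} ≤ n.choose k := by
    rw [hn', ← card_powersetCard]
    refine card_le_card fun U hU => ?_
    rw [mem_filter] at hU
    exact mem_powersetCard.2 ⟨hS U hU.1, hU.2⟩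
  have hs1 := hsmall 1
  have hs2 := hsmall (n - 1)
  rw [Nat.choose_one_right] at hs1
  rw [Nat.choose_symm (by omega), Nat.choose_one_right] at hs2
  -- A proper nonempty set separates at least `2 * (n - 2)` pairs, except that singletons and their
  -- complements separate only `n - 1`, a deficit of `n - 3`.
  have hlow : #𝓐 * (2 * (n - 2)) ≤ ∑ U ∈ 𝓐, #U * (n - #U)
      + (#{U ∈ 𝓐 | #U = 1} + #{U ∈ 𝓐 | #U = n - 1}) * (n - 3) := by
    rw [card_filter, card_filter, ← sum_add_distrib, sum_mul, ← sum_add_distrib, ← smul_eq_mul]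
    refine card_nsmul_le_sum _ _ _ fun U hU => ?_
    have hpos : 0 < #U :=
      card_pos.2 (nonempty_iff_ne_empty.2 fun h => h0 (h ▸ hU))
    have hlt : #U < n :=
      card_lt_card ((hS U hU).ssubset_of_ne fun h => h1 (h ▸ hU))
    obtain ⟨b, hb⟩ := Nat.exists_eq_add_of_lt hlt
    generalize #U = u at *
    obtain ⟨c, rfl⟩ : ∃ c, u = c + 1 := ⟨u - 1, by omega⟩
    have e1 : n - (c + 1) = b + 1 := by omega
    have e2 : n - 2 = c + b := by omega
    have e3 : c + b + 2 = n := by omega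
    rw [e1, e2]
    by_cases hc : c = 0
    · subst hc
      simp only [zero_add, if_true]
      split_ifs <;> simp only [Nat.reduceAdd, one_mul, Nat.add_zero] <;> omega
    · by_cases hb0 : b = 0
      · subst hb0
        rw [if_pos (by omega : c + 1 = n - 1)]
        split_ifs <;> simp only [Nat.reduceAdd, one_mul, Nat.zero_add, mul_one] <;> omega
      · have : 0 < c := by omega
        have : 0 < b := by omega
        refine le_add_right ?_
        nlinarith [mul_nonneg (show (0 : ℤ) ≤ c - 1 by omega) (show (0 : ℤ) ≤ b - 1 by omega)]
  obtain ⟨l, hl⟩ : ∃ l, n = l + 5 := ⟨n - 5, by omega⟩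
  clear_value n
  subst hl
  have hm : (#{U ∈ 𝓐 | #U = 1} + #{U ∈ 𝓐 | #U = l + 5 - 1}) * (l + 5 - 3)
      ≤ (2 * (l + 5)) * (l + 2) := Nat.mul_le_mul (by omega) (by omega)
  have e1 : (l + 5) * (l + 5) - (l + 5) = (l + 5) * (l + 4) := by
    rw [← Nat.mul_sub_one]; rfl
  rw [e1] at hsum
  rw [hcount] at hlow
  have e2 : l + 5 - 2 = l + 3 := rfl
  rw [e2] at hlow
  by_contra! hcon
  -- For `n = 5` the estimate reads `6 * #𝓐 ≤ 140`, and integrality is needed to reach 23.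
  rcases Nat.eq_zero_or_pos l with rfl | hlpos
  · omega
  · nlinarith

end Families

/-! ### Ordering the ground set by degree -/

section Sorted

variable {α : Type*} [DecidableEq α]

/-- The degree difference equals the difference of the two separation counts, here at most `6 - 1`.
-/
theorem SeparatesFew.degree_le {𝓐 : Finset (Finset α)} (hA : SeparatesFew 𝓐) {x y : α}
    (hd : 0 < diffCount 𝓐 x y) : familyDegree 𝓐 y ≤ familyDegree 𝓐 x + 5 := by
  have := hA _ _ hd
  have := familyDegree_add_diffCount 𝓐 x y
  omega

/-- `e 0, …, e (n - 1)` enumerates `S` by nondecreasing degree in `𝓐`. -/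
structure IsSortedEnum (𝓐 : Finset (Finset α)) (S : Finset α) (n : ℕ) (e : ℕ → α) : Prop where
  injOn : Set.InjOn e (range n)
  image_eq : (range n).image e = S
  degree_mono : ∀ i j, i ≤ j → j < n → familyDegree 𝓐 (e i) ≤ familyDegree 𝓐 (e j)

theorem exists_isSortedEnum (𝓐 : Finset (Finset α)) {S : Finset α} (hS : S.Nonempty) :
    ∃ e, IsSortedEnum 𝓐 S #S e := by
  set f : Fin #S → ℕ := fun k => familyDegree 𝓐 (S.equivFin.symm k : α) with hf
  set g : Fin #S → α := fun k => (S.equivFin.symm (Tuple.sort f k) : α) with hg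
  have hgm (k : Fin #S) : g k ∈ S := (S.equivFin.symm (Tuple.sort f k)).2
  obtain ⟨x₀, -⟩ := hS
  refine ⟨fun k => if h : k < #S then g ⟨k, h⟩ else x₀, ?_, ?_, ?_⟩
  · intro i hi j hj hij
    rw [mem_coe, mem_range] at hi hj
    simp only [hi, hj, dif_pos, hg] at hij
    have := (Tuple.sort f).injective (S.equivFin.symm.injective (Subtype.ext hij))
    simpa using this
  · ext x
    simp only [mem_image, mem_range]
    constructor
    · rintro ⟨k, hk, rfl⟩
      simpa [hk] using hgm _
    · intro hx
      refine ⟨(Tuple.sort f).symm (S.equivFin ⟨x, hx⟩), Fin.is_lt _, ?_⟩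
      simp [hg]
  · intro i j hij hj
    simp only [hj, hij.trans_lt hj, dif_pos]
    exact Tuple.monotone_sort f (show (⟨i, hij.trans_lt hj⟩ : Fin #S) ≤ ⟨j, hj⟩ from hij)

/-- Every cut of the enumeration is crossed in the direction against the order. -/
def IsLinked (𝓐 : Finset (Finset α)) (n : ℕ) (e : ℕ → α) : Prop :=
  ∀ k, 0 < k → k < n → ∃ i j, i < k ∧ k ≤ j ∧ j < n ∧ 0 < diffCount 𝓐 (e i) (e j)

namespace IsSortedEnum

variable {𝓐 : Finset (Finset α)} {S : Finset α} {n : ℕ} {e : ℕ → α}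

theorem mem (h : IsSortedEnum 𝓐 S n e) {k : ℕ} (hk : k < n) : e k ∈ S :=
  h.image_eq ▸ mem_image_of_mem e (mem_range.2 hk)

theorem exists_eq (h : IsSortedEnum 𝓐 S n e) {x : α} (hx : x ∈ S) : ∃ k < n, e k = x := by
  simpa [← h.image_eq] using hx

theorem diffCount_pos_symm (h : IsSortedEnum 𝓐 S n e) {i j : ℕ} (hij : i ≤ j) (hj : j < n)
    (hd : 0 < diffCount 𝓐 (e i) (e j)) : 0 < diffCount 𝓐 (e j) (e i) := by
  have := h.degree_mono i j hij hj
  have := familyDegree_add_diffCount 𝓐 (e i) (e j)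
  omega

theorem degree_succ_le (h : IsSortedEnum 𝓐 S n e) (hA : SeparatesFew 𝓐) (hl : IsLinked 𝓐 n e)
    {k : ℕ} (hk : k + 1 < n) : familyDegree 𝓐 (e (k + 1)) ≤ familyDegree 𝓐 (e k) + 5 := by
  obtain ⟨i, j, hi, hkj, hj, hd⟩ := hl (k + 1) (by omega) hk
  have := hA.degree_le hd
  have := h.degree_mono _ _ hkj hj
  have := h.degree_mono i k (by omega) (by omega)
  omega

/-- A gain of 25 would force all five gaps to equal 5. Crossings against the order span a degree gap
of at most 5, so the middle cut is crossed by its adjacent pair only, and at least `5 + 1` sets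
separate that pair in the forward direction. The same limit on crossings leaves at most three such
sets. -/
theorem degree_add_five_le (h : IsSortedEnum 𝓐 S n e) (hS : ∀ U ∈ 𝓐, U ⊆ S)
    (hA : SeparatesFew 𝓐) (hl : IsLinked 𝓐 n e) {k : ℕ} (hk : k + 5 < n) :
    familyDegree 𝓐 (e (k + 5)) ≤ familyDegree 𝓐 (e k) + 24 := by
  by_contra! hcon
  have g0 : familyDegree 𝓐 (e (k + 1)) ≤ familyDegree 𝓐 (e k) + 5 :=
    h.degree_succ_le hA hl (by omega)
  have g1 : familyDegree 𝓐 (e (k + 2)) ≤ familyDegree 𝓐 (e (k + 1)) + 5 :=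
    h.degree_succ_le hA hl (by omega)
  have g2 : familyDegree 𝓐 (e (k + 3)) ≤ familyDegree 𝓐 (e (k + 2)) + 5 :=
    h.degree_succ_le hA hl (by omega)
  have g3 : familyDegree 𝓐 (e (k + 4)) ≤ familyDegree 𝓐 (e (k + 3)) + 5 :=
    h.degree_succ_le hA hl (by omega)
  have g4 : familyDegree 𝓐 (e (k + 5)) ≤ familyDegree 𝓐 (e (k + 4)) + 5 :=
    h.degree_succ_le hA hl (by omega)
  have cross {i j : ℕ} {U} (hU : U ∈ 𝓐) (hi : e i ∈ U) (hjU : e j ∉ U) :=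
    hA.degree_le (diffCount_pos hU hi hjU)
  have low {i : ℕ} (hi : i ≤ k) := h.degree_mono i k hi (by omega)
  have high {j : ℕ} (hj : k + 5 ≤ j) (hjn : j < n) := h.degree_mono _ j hj hjn
  have hpos : 0 < diffCount 𝓐 (e (k + 2)) (e (k + 3)) := by
    obtain ⟨i, j, hi, hkj, hj, hd⟩ := hl (k + 3) (by omega) (by omega)
    have hb := hA.degree_le hd
    have hi' : i = k + 2 := by
      by_contra hne
      have := h.degree_mono i (k + 1) (by omega) (by omega)
      have := h.degree_mono _ j hkj hj
      omega
    have hj' : j = k + 3 := by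
      by_contra hne
      have := h.degree_mono (k + 4) j (by omega) hj
      have := h.degree_mono i (k + 2) (by omega) (by omega)
      omega
    rwa [hi', hj'] at hd
  have heq := familyDegree_add_diffCount 𝓐 (e (k + 2)) (e (k + 3))
  have hle : diffCount 𝓐 (e (k + 3)) (e (k + 2)) ≤ 3 := by
    set T : Finset α := (Finset.Ico (k + 3) n).image e with hT
    have hmemT {i : ℕ} (hi : i < n) : e i ∈ T ↔ k + 3 ≤ i := by
      rw [hT, mem_image]
      constructor
      · rintro ⟨j, hj, hji⟩
        rw [mem_Ico] at hj
        have := h.injOn (by simpa using hj.2) (by simpa using hi) hji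
        omega
      · exact fun hki => ⟨i, mem_Ico.2 ⟨hki, hi⟩, rfl⟩
    have hTS : T ⊆ S := by
      intro x hx
      obtain ⟨i, hi, rfl⟩ := mem_image.1 hx
      exact h.mem (mem_Ico.1 hi).2
    -- Such a set agrees with the final segment `T` except possibly at `k + 1` and `k + 4`, and it
    -- cannot differ at both, since that crossing would span a gap of 15.
    have hsub : {U ∈ 𝓐 | e (k + 3) ∈ U ∧ e (k + 2) ∉ U} ⊆
        {T, insert (e (k + 1)) T, T.erase (e (k + 4))} := by
      intro U hU
      obtain ⟨hUA, h3, h2⟩ := by simpa using hU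
      have hlow {i : ℕ} (hi : i < k + 3) (hiU : e i ∈ U) : i = k + 1 := by
        by_contra hne
        have : i ≠ k + 2 := fun h => h2 (h ▸ hiU)
        have := cross hUA hiU h2
        have := low (by omega : i ≤ k)
        omega
      have hhigh {j : ℕ} (hj : k + 3 ≤ j) (hjn : j < n) (hjU : e j ∉ U) : j = k + 4 := by
        by_contra hne
        have : j ≠ k + 3 := fun h => hjU (h ▸ h3)
        have := cross hUA h3 hjU
        have := high (by omega : k + 5 ≤ j) hjn
        omega
      have hnot : ¬ (e (k + 1) ∈ U ∧ e (k + 4) ∉ U) := fun hh => by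
        have := cross hUA hh.1 hh.2
        omega
      have hext {V : Finset α} (hV : V ⊆ S) (hi : ∀ i < n, e i ∈ U ↔ e i ∈ V) : U = V := by
        ext x
        constructor
        · intro hx
          obtain ⟨i, hin, rfl⟩ := h.exists_eq (hS U hUA hx)
          exact (hi i hin).1 hx
        · intro hx
          obtain ⟨i, hin, rfl⟩ := h.exists_eq (hV hx)
          exact (hi i hin).2 hx
      have hne {i j : ℕ} (hi : i < n) (hj : j < n) : e i = e j ↔ i = j :=
        ⟨fun he => h.injOn (by simpa using hi) (by simpa using hj) he, fun he => he ▸ rfl⟩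
      simp only [mem_insert, mem_singleton]
      by_cases c1 : e (k + 1) ∈ U
      · right; left
        have c4 : e (k + 4) ∈ U := by tauto
        refine hext (insert_subset (h.mem (by omega)) hTS) fun i hi => ?_
        rw [mem_insert, hmemT hi, hne hi (by omega)]
        constructor
        · intro hiU
          by_contra! hc
          exact hc.1 (hlow (by omega) hiU)
        · rintro (rfl | hi3)
          · exact c1
          · by_contra hiU
            exact hiU (hhigh hi3 hi hiU ▸ c4)
      · by_cases c4 : e (k + 4) ∈ U
        · left
          refine hext hTS fun i hi => ?_
          rw [hmemT hi]
          constructor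
          · intro hiU
            by_contra! hc
            exact c1 (hlow hc hiU ▸ hiU)
          · intro hi3
            by_contra hiU
            exact hiU (hhigh hi3 hi hiU ▸ c4)
        · right; right
          refine hext ((erase_subset _ _).trans hTS) fun i hi => ?_
          rw [mem_erase, hmemT hi, Ne, hne hi (by omega)]
          constructor
          · intro hiU
            refine ⟨fun hi4 => c4 (hi4 ▸ hiU), ?_⟩
            by_contra! hc
            exact c1 (hlow hc hiU ▸ hiU)
          · rintro ⟨hi4, hi3⟩
            by_contra hiU
            exact hi4 (hhigh hi3 hi hiU)
    exact (card_le_card hsub).trans card_le_three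
  omega

theorem degree_add_le (h : IsSortedEnum 𝓐 S n e) (hS : ∀ U ∈ 𝓐, U ⊆ S)
    (hA : SeparatesFew 𝓐) (hl : IsLinked 𝓐 n e) (k d : ℕ) (hk : k + d < n) :
    familyDegree 𝓐 (e (k + d)) ≤ familyDegree 𝓐 (e k) + 24 * (d / 5) + 5 * (d % 5) := by
  induction d using Nat.strong_induction_on with
  | _ d ih =>
    rcases Nat.eq_zero_or_pos d with rfl | hd
    · simp
    · by_cases h5 : d < 5
      · have := ih (d - 1) (by omega) (by omega)
        have hs := h.degree_succ_le hA hl (k := k + (d - 1)) (by omega)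
        rw [show k + (d - 1) + 1 = k + d by omega] at hs
        omega
      · have := ih (d - 5) (by omega) (by omega)
        have hs := h.degree_add_five_le hS hA hl (k := k + (d - 5)) (by omega)
        rw [show k + (d - 5) + 5 = k + d by omega] at hs
        omega

theorem card_eq (h : IsSortedEnum 𝓐 S n e) : #S = n := by
  rw [← h.image_eq, card_image_of_injOn h.injOn, card_range]

theorem card_image_of_subset (h : IsSortedEnum 𝓐 S n e) {s : Finset ℕ} (hs : s ⊆ range n) :
    #(s.image e) = #s :=
  card_image_of_injOn (h.injOn.mono (by exact_mod_cast hs))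

/-- The number of sets containing the element of least degree. -/
theorem degree_zero_bound (h : IsSortedEnum 𝓐 S n e) (hS : ∀ U ∈ 𝓐, U ⊆ S) (h1 : S ∉ 𝓐)
    (hA : SeparatesFew 𝓐) {q : ℕ} (hq0 : 0 < q) (hqn : q < n)
    (hq : ∀ j, q < j → j < n → diffCount 𝓐 (e 0) (e j) = 0) :
    5 * familyDegree 𝓐 (e 0) + 19 ≤ 24 * q := by
  set T : Finset α := (Finset.Icc 1 q).image e with hT
  -- Complements turn sets through `e 0` into nonempty sets supported on `e 1, …, e q`.
  set 𝓒 : Finset (Finset α) := {U ∈ 𝓐 | e 0 ∈ U}.image (fun U => S \ U) with hC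
  have hTc : #T = q := by
    rw [hT, h.card_image_of_subset (fun i hi => by simp at hi ⊢; omega)]; simp
  have hinj : Set.InjOn (fun U => S \ U) (𝓐 : Set (Finset α)) := fun U hU V hV hUV => by
    rw [← Finset.sdiff_sdiff_eq_self (hS U hU), ← Finset.sdiff_sdiff_eq_self (hS V hV)]
    exact congrArg (S \ ·) hUV
  have hCc : #𝓒 = familyDegree 𝓐 (e 0) :=
    card_image_of_injOn (hinj.mono (coe_subset.2 (filter_subset _ _)))
  rw [← hCc, ← hTc]
  refine five_mul_card_le_of_degree_le ?_ ?_ ?_ (by omega)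
  · intro V hV x hx
    obtain ⟨U, hU, rfl⟩ := mem_image.1 hV
    rw [mem_filter] at hU
    obtain ⟨hxS, hxU⟩ := mem_sdiff.1 hx
    obtain ⟨j, hj, rfl⟩ := h.exists_eq hxS
    refine mem_image_of_mem e (mem_Icc.2 ⟨Nat.pos_of_ne_zero fun h0 => hxU (h0 ▸ hU.2), ?_⟩)
    by_contra! hqj
    exact (diffCount_pos hU.1 hU.2 hxU).ne' (hq j hqj hj)
  · intro hV
    obtain ⟨U, hU, hUS⟩ := mem_image.1 hV
    rw [mem_filter] at hU
    exact h1 ((hS U hU.1).antisymm (sdiff_eq_empty_iff_subset.1 hUS) ▸ hU.1)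
  · intro x hx
    obtain ⟨j, hj, rfl⟩ := mem_image.1 hx
    rw [mem_Icc] at hj
    have hle : #{V ∈ 𝓒 | e j ∈ V} ≤ diffCount 𝓐 (e 0) (e j) := by
      refine (card_le_card ?_).trans (card_image_le (f := fun U => S \ U))
      intro V hV
      obtain ⟨hV, hjV⟩ := mem_filter.1 hV
      obtain ⟨U, hU, rfl⟩ := mem_image.1 hV
      rw [mem_filter] at hU
      exact mem_image_of_mem _ (mem_filter.2 ⟨hU.1, hU.2, (mem_sdiff.1 hjV).2⟩)
    rcases Nat.eq_zero_or_pos (diffCount 𝓐 (e 0) (e j)) with h0 | hpos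
    · omega
    · exact hle.trans (hA _ _ (h.diffCount_pos_symm (by omega) (by omega) hpos))

/-- The number of sets avoiding the element of greatest degree. -/
theorem card_sub_degree_last_bound (h : IsSortedEnum 𝓐 S (n + 1) e) (hS : ∀ U ∈ 𝓐, U ⊆ S)
    (h0 : ∅ ∉ 𝓐) (hA : SeparatesFew 𝓐) {p : ℕ} (hpn : p < n)
    (hp : ∀ i, i < p → diffCount 𝓐 (e i) (e n) = 0) :
    5 * #{U ∈ 𝓐 | e n ∉ U} + 19 ≤ 24 * (n - p) := by
  set T : Finset α := (Finset.Ico p n).image e with hT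
  have hTc : #T = n - p := by
    rw [hT, h.card_image_of_subset (fun i hi => by simp at hi ⊢; omega)]; simp
  rw [← hTc]
  refine five_mul_card_le_of_degree_le ?_ ?_ ?_ (by omega)
  · intro U hU x hx
    rw [mem_filter] at hU
    obtain ⟨i, hi, rfl⟩ := h.exists_eq (hS U hU.1 hx)
    have hin : i ≠ n := fun hn => hU.2 (hn ▸ hx)
    refine mem_image_of_mem e (mem_Ico.2 ⟨?_, by omega⟩)
    by_contra! hip
    exact (diffCount_pos hU.1 hx hU.2).ne' (hp i hip)
  · exact fun hV => h0 (mem_filter.1 hV).1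
  · intro x hx
    obtain ⟨i, hi, rfl⟩ := mem_image.1 hx
    rw [mem_Ico] at hi
    have hle : #{V ∈ {U ∈ 𝓐 | e n ∉ U} | e i ∈ V} = diffCount 𝓐 (e i) (e n) := by
      rw [filter_filter]
      simp only [diffCount, and_comm]
    rw [hle]
    rcases Nat.eq_zero_or_pos (diffCount 𝓐 (e i) (e n)) with h0 | hpos
    · omega
    · exact hA _ _ (h.diffCount_pos_symm (by omega) (by omega) hpos)

theorem card_bound_of_isLinked (h : IsSortedEnum 𝓐 S n e) (hS : ∀ U ∈ 𝓐, U ⊆ S)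
    (h0 : ∅ ∉ 𝓐) (h1 : S ∉ 𝓐) (hA : SeparatesFew 𝓐) (hl : IsLinked 𝓐 n e) (hn : 0 < n) :
    5 * #𝓐 + 5 ≤ 24 * n := by
  by_cases hn5 : n < 5
  -- Below five points, excluding `∅` and `S` from the power set is already enough.
  · have hc : #(insert S 𝓐) + 1 ≤ 2 ^ #S := by
      refine card_add_one_le_two_pow (T := S) (fun U hU => ?_) ?_
      · rcases mem_insert.1 hU with rfl | hU
        · exact subset_rfl
        · exact hS U hU
      · rw [mem_insert, not_or]
        refine ⟨fun hE => ?_, h0⟩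
        have := h.card_eq
        rw [← hE, card_empty] at this
        omega
    rw [card_insert_of_notMem h1, h.card_eq] at hc
    interval_cases n <;> omega
  obtain ⟨m, rfl⟩ : ∃ m, n = m + 1 := ⟨n - 1, by omega⟩
  by_cases hr : familyDegree 𝓐 (e m) ≤ familyDegree 𝓐 (e 0) + 12
  · rw [← h.card_eq]
    refine card_bound_of_diffCount_add_le hS h0 h1 (by rw [h.card_eq]; omega) fun x hx y hy => ?_
    obtain ⟨i, hi, rfl⟩ := h.exists_eq hx
    obtain ⟨j, hj, rfl⟩ := h.exists_eq hy
    have := familyDegree_add_diffCount 𝓐 (e i) (e j)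
    have := h.degree_mono 0 i (by omega) hi
    have := h.degree_mono 0 j (by omega) hj
    have := h.degree_mono i m (by omega) (by omega)
    have := h.degree_mono j m (by omega) (by omega)
    have := hA (e i) (e j)
    have := hA (e j) (e i)
    omega
  · obtain ⟨q, hq, hqmax⟩ := exists_max_image
      {j ∈ range (m + 1) | 0 < j ∧ 0 < diffCount 𝓐 (e 0) (e j)} id (by
        obtain ⟨i, j, hi, hj, hjm, hd⟩ := hl 1 (by omega) (by omega)
        obtain rfl : i = 0 := by omega
        exact ⟨j, by simp; omega⟩)
    obtain ⟨p, hp, hpmin⟩ := exists_min_image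
      {i ∈ range m | 0 < diffCount 𝓐 (e i) (e m)} id (by
        obtain ⟨i, j, hi, hj, hjm, hd⟩ := hl m (by omega) (by omega)
        obtain rfl : j = m := by omega
        exact ⟨i, by simp; omega⟩)
    simp only [mem_filter, mem_range, id] at hq hp hqmax hpmin
    have hq5 := hA.degree_le hq.2.2
    have hp5 := hA.degree_le hp.2
    -- Otherwise the total range would be at most `5 + 5`, below the assumed 13.
    have hqp : q < p := by
      by_contra! hpq
      have := h.degree_mono p q hpq hq.1
      omega
    have b0 := h.degree_zero_bound hS h1 hA hq.2.1 hq.1 fun j hqj hj => by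
      by_contra hne
      have := hqmax j ⟨hj, by omega, by omega⟩
      omega
    have b1 := h.card_sub_degree_last_bound hS h0 hA hp.1 fun i hi => by
      by_contra hne
      have := hpmin i ⟨by omega, by omega⟩
      omega
    have hmid := h.degree_add_le hS hA hl q (p - q) (by omega)
    rw [show q + (p - q) = p by omega] at hmid
    have hN : familyDegree 𝓐 (e m) + #{U ∈ 𝓐 | e m ∉ U} = #𝓐 :=
      card_filter_add_card_filter_not _
    -- With `d = p - q`, five times the middle gain is `24 * d + d % 5`. The ends contribute `24 * q
    -- - 19` and `24 * (m - p) - 19`, the two links 25 each, so `5 * #𝓐 ≤ 24 * m + 16`.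
    omega

end IsSortedEnum

theorem card_bound {𝓐 : Finset (Finset α)} {S : Finset α} (hne : S.Nonempty)
    (hS : ∀ U ∈ 𝓐, U ⊆ S) (h0 : ∅ ∉ 𝓐) (h1 : S ∉ 𝓐) (hA : SeparatesFew 𝓐) :
    5 * #𝓐 + 5 ≤ 24 * #S := by
  induction hn : #S using Nat.strong_induction_on generalizing S 𝓐 with
  | _ n ih =>
    obtain ⟨e, h⟩ := exists_isSortedEnum 𝓐 hne
    rw [hn] at h
    by_cases hl : IsLinked 𝓐 n e
    · exact h.card_bound_of_isLinked hS h0 h1 hA hl (hn ▸ card_pos.2 hne)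
    unfold IsLinked at hl
    push Not at hl
    obtain ⟨k, hk0, hkn, hk⟩ := hl
    set S₁ : Finset α := (range k).image e with hS₁
    set S₂ : Finset α := (Finset.Ico k n).image e with hS₂
    have hc₁ : #S₁ = k := by
      rw [hS₁, h.card_image_of_subset (range_subset_range.2 hkn.le), card_range]
    have hc₂ : #S₂ = n - k := by
      rw [hS₂, h.card_image_of_subset (fun i hi => by simp at hi ⊢; omega), Nat.card_Ico]
    have hunion : S₁ ∪ S₂ = S := by
      rw [← h.image_eq, hS₁, hS₂, ← image_union]
      congr 1
      ext i
      simp only [mem_union, mem_range, mem_Ico]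
      omega
    have hcases : ∀ U ∈ 𝓐, U ⊆ S₂ ∨ S₂ ⊆ U := by
      intro U hU
      by_contra! hcon
      obtain ⟨x, hxU, hx⟩ := not_subset.1 hcon.1
      obtain ⟨y, hy, hyU⟩ := not_subset.1 hcon.2
      have hx₁ : x ∈ S₁ := by
        have := hS U hU hxU
        rw [← hunion, mem_union] at this
        tauto
      obtain ⟨i, hi, rfl⟩ := mem_image.1 hx₁
      obtain ⟨j, hj, rfl⟩ := mem_image.1 hy
      rw [mem_range] at hi
      rw [mem_Ico] at hj
      have := hk i j hi hj.1 hj.2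
      have := diffCount_pos hU hxU hyU
      omega
    set 𝓑 : Finset (Finset α) := {U ∈ 𝓐 | U ⊂ S₂} with hB
    set 𝓒 : Finset (Finset α) := {U ∈ 𝓐 | S₂ ⊂ U} with hC
    have hcard : #𝓐 ≤ #𝓑 + #𝓒 + 1 := by
      have : 𝓐 ⊆ insert S₂ (𝓑 ∪ 𝓒) := by
        intro U hU
        rw [mem_insert, mem_union, hB, hC, mem_filter, mem_filter]
        by_cases hUS : U = S₂
        · exact Or.inl hUS
        · rcases hcases U hU with hc | hc
          · exact Or.inr (Or.inl ⟨hU, hc.ssubset_of_ne hUS⟩)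
          · exact Or.inr (Or.inr ⟨hU, hc.ssubset_of_ne (Ne.symm hUS)⟩)
      exact (card_le_card this).trans ((card_insert_le _ _).trans
        (Nat.add_le_add_right (card_union_le _ _) 1))
    have hb := ih (n - k) (by omega) (𝓐 := 𝓑) (S := S₂) (card_pos.1 (by omega))
      (fun U hU => (mem_filter.1 hU).2.subset) (fun hU => h0 (mem_filter.1 hU).1)
      (fun hU => (mem_filter.1 hU).2.ne rfl) (hA.mono (filter_subset _ _)) hc₂
    -- Removing the common part `S₂` is injective on `𝓒` and moves it to the ground set `S₁`.
    set 𝓓 : Finset (Finset α) := 𝓒.image (fun U => U \ S₂) with hD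
    have hDc : #𝓓 = #𝓒 := by
      refine card_image_of_injOn fun U hU V hV hUV => ?_
      have hU' := (mem_filter.1 (mem_coe.1 hU)).2.subset
      have hV' := (mem_filter.1 (mem_coe.1 hV)).2.subset
      rw [← sdiff_union_of_subset hU', ← sdiff_union_of_subset hV']
      exact congrArg (· ∪ S₂) hUV
    have hdle (x y : α) (hx : x ∉ S₂) (hy : y ∉ S₂) : diffCount 𝓓 x y ≤ diffCount 𝓐 x y := by
      refine (card_le_card ?_).trans (card_image_le (f := fun U => U \ S₂))
      intro V hV
      obtain ⟨hV, hxy⟩ := mem_filter.1 hV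
      obtain ⟨U, hU, rfl⟩ := mem_image.1 hV
      refine mem_image_of_mem _ (mem_filter.2 ⟨(mem_filter.1 hU).1, ?_⟩)
      simpa [hx, hy] using hxy
    have hsupp (x y : α) (hxy : 0 < diffCount 𝓓 x y) : x ∉ S₂ := by
      obtain ⟨V, hV, hxV, -⟩ := exists_of_diffCount_pos hxy
      obtain ⟨U, hU, rfl⟩ := mem_image.1 hV
      exact (mem_sdiff.1 hxV).2
    have hc := ih k hkn (𝓐 := 𝓓) (S := S₁) (card_pos.1 (by omega))
      (fun V hV x hx => by
        obtain ⟨U, hU, rfl⟩ := mem_image.1 hV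
        have hx' := mem_sdiff.1 hx
        have := hS U (mem_filter.1 hU).1 hx'.1
        rw [← hunion, mem_union] at this
        tauto)
      (fun hV => by
        obtain ⟨U, hU, hUV⟩ := mem_image.1 hV
        exact (mem_filter.1 hU).2.not_subset (sdiff_eq_empty_iff_subset.1 hUV))
      (fun hV => by
        obtain ⟨U, hU, hUV⟩ := mem_image.1 hV
        refine h1 ?_
        rw [← hunion, ← hUV, sdiff_union_of_subset (mem_filter.1 hU).2.subset]
        exact (mem_filter.1 hU).1)
      (fun x y hyx => by
        rcases Nat.eq_zero_or_pos (diffCount 𝓓 x y) with hz | hxy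
        · omega
        · have hx := hsupp x y hxy
          have hy := hsupp y x hyx
          exact (hdle x y hx hy).trans (hA x y (hyx.trans_le (hdle y x hy hx))))
      hc₁
    omega

end Sorted

/-! ### From matrices to set families -/

theorem isConfig_F0p10 {ι κ : Type*} [Fintype κ] [DecidableEq κ] {A : Mat01 ι κ} {p : ℕ} {i j : ι}
    (h1 : p ≤ #{c | A i c = 1 ∧ A j c = 0}) (h2 : ∃ c, A i c = 0 ∧ A j c = 1) :
    IsConfig (F0p10 p) A := by
  obtain ⟨d, hd0, hd1⟩ := h2
  have hij : i ≠ j := by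
    rintro rfl
    rw [hd0] at hd1
    exact absurd hd1 (by decide)
  obtain ⟨f⟩ : Nonempty (Fin p ↪ {c // c ∈ ({c | A i c = 1 ∧ A j c = 0} : Finset κ)}) :=
    Function.Embedding.nonempty_of_card_le (by rwa [Fintype.card_fin, Fintype.card_coe])
  have hf (c : Fin p) : A i (f c) = 1 ∧ A j (f c) = 0 := (mem_filter.1 (f c).2).2
  refine ⟨⟨![i, j], ?_⟩, ⟨Fin.snoc (α := fun _ => κ) (fun c => (f c : κ)) d, ?_⟩, ?_⟩
  · intro x y hxy
    fin_cases x <;> fin_cases y <;> simp_all [eq_comm]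
  · rw [Fin.snoc_injective_iff]
    refine ⟨Subtype.val_injective.comp f.injective, ?_⟩
    rintro ⟨c, hc⟩
    have := (hf c).1
    simp only [] at hc
    rw [hc, hd0] at this
    exact absurd this (by decide)
  · refine Matrix.ext fun x c => ?_
    induction c using Fin.lastCases with
    | last =>
      rw [Matrix.submatrix_apply, Function.Embedding.coeFn_mk, Function.Embedding.coeFn_mk,
        Fin.snoc_last]
      fin_cases x
      · exact hd0.trans (show 0 = F0p10 p 0 (Fin.last p) by simp [F0p10])
      · exact hd1.trans (show 1 = F0p10 p 1 (Fin.last p) by simp [F0p10])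
    | cast c =>
      rw [Matrix.submatrix_apply, Function.Embedding.coeFn_mk, Function.Embedding.coeFn_mk,
        Fin.snoc_castSucc]
      fin_cases x
      · exact (hf c).1.trans
          (show 1 = F0p10 p 0 c.castSucc by simp [F0p10, (Fin.castSucc_lt_last c).ne])
      · exact (hf c).2.trans
          (show 0 = F0p10 p 1 c.castSucc by simp [F0p10, (Fin.castSucc_lt_last c).ne])

theorem IsConfig.exists_rows_F0p10 {ι κ : Type*} [Fintype κ] [DecidableEq κ] {A : Mat01 ι κ}
    {p : ℕ} (h : IsConfig (F0p10 p) A) :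
    ∃ i j, p ≤ #{c | A i c = 1 ∧ A j c = 0} ∧ ∃ c, A i c = 0 ∧ A j c = 1 := by
  obtain ⟨r, c, h⟩ := h
  have hc (x : Fin 2) (y : Fin (p + 1)) : A (r x) (c y) = F0p10 p x y := congrFun₂ h x y
  refine ⟨r 0, r 1, ?_, c (Fin.last p), ?_, ?_⟩
  · have : univ.map (Fin.castSuccEmb.trans c) ⊆
        ({c | A (r 0) c = 1 ∧ A (r 1) c = 0} : Finset κ) := by
      intro y hy
      obtain ⟨z, -, rfl⟩ := mem_map.1 hy
      simp [hc, F0p10, (Fin.castSucc_lt_last z).ne]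
    simpa using card_le_card this
  · simp [hc, F0p10]
  · simp [hc, F0p10]


theorem Avoids.card_le {ι κ : Type*} [Fintype ι] [Fintype κ] {A : Mat01 ι κ}
    (hA : Avoids (F0p10 7) A) : 5 * Fintype.card κ ≤ 24 * Fintype.card ι + 5 := by
  classical
  set col : κ → Finset ι := fun c => {i | A i c = 1} with hcol
  have hmem (i : ι) (c : κ) : i ∈ col c ↔ A i c = 1 := by simp [hcol]
  have hmem0 (i : ι) (c : κ) : i ∉ col c ↔ A i c = 0 := by
    rw [hmem]
    generalize A i c = a
    revert a
    decide
  have hinj : Function.Injective col := fun c d hcd => hA.1 c d fun i => by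
    have h1 := hmem i c
    rw [hcd] at h1
    have h2 := hmem i d
    have h3 := hmem0 i d
    by_cases hi : i ∈ col d
    · rw [h1.1 hi, h2.1 hi]
    · rw [h3.1 hi]
      exact (hmem0 i c).1 (hcd ▸ hi)
  set 𝓐 : Finset (Finset ι) := univ.image col with hF
  have hcard : #𝓐 = Fintype.card κ := card_image_of_injective _ hinj
  have hdiff (x y : ι) : diffCount 𝓐 x y = #{c | A x c = 1 ∧ A y c = 0} := by
    unfold diffCount
    rw [hF, filter_image, card_image_of_injective _ hinj]
    exact congrArg card (filter_congr fun c _ => and_congr (hmem x c) (hmem0 y c))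
  have hsep : SeparatesFew 𝓐 := by
    intro x y hyx
    by_contra! hxy
    rw [hdiff] at hxy hyx
    obtain ⟨c, hc⟩ := card_pos.1 hyx
    rw [mem_filter] at hc
    exact hA.2 (isConfig_F0p10 hxy ⟨c, hc.2.2, hc.2.1⟩)
  rw [← hcard]
  rcases isEmpty_or_nonempty ι with hι | hι
  · have : #𝓐 ≤ 1 := card_le_one.2 fun U _ V _ => Subsingleton.elim U V
    omega
  -- Restoring the two erased sets adds at most 10 to `5 * #𝓐`, turning the `+ 5` on the left into
  -- `+ 5` on the right.
  · have hb := card_bound (𝓐 := (𝓐.erase ∅).erase univ) univ_nonempty (fun U _ => subset_univ U)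
      (by simp) (by simp) (hsep.mono ((erase_subset _ _).trans (erase_subset _ _)))
    rw [card_univ] at hb
    have h1 := pred_card_le_card_erase (s := 𝓐) (a := ∅)
    have h2 := pred_card_le_card_erase (s := 𝓐.erase ∅) (a := univ)
    omega

theorem forb_F0p10_seven_le (m : ℕ) : 5 * forb m (F0p10 7) ≤ 24 * m + 5 := by
  obtain ⟨A, hA⟩ := (isGreatest_forb m (F0p10 7)).1
  simpa using hA.card_le

theorem Avoids.card_le_forb {α β ι κ : Type*} [Nonempty β] [Fintype ι] [Fintype κ]
    {F : Mat01 α β} {A : Mat01 ι κ} (hA : Avoids F A) :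
    Fintype.card κ ≤ forb (Fintype.card ι) F := by
  set f := (Fintype.equivFin ι).symm
  set g := (Fintype.equivFin κ).symm
  refine (isGreatest_forb _ F).2 ⟨A.submatrix f g, fun c d h => ?_, ?_⟩
  · exact g.injective (hA.1 _ _ fun i => by simpa using h (f.symm i))
  · rintro ⟨r, c, h⟩
    exact hA.2 ⟨r.trans f.toEmbedding, c.trans g.toEmbedding, h⟩

/-! ### The extremal block construction -/

theorem isSimple_B24 : IsSimple B24 := by
  unfold IsSimple B24 M25
  decide

/-- This is why the column of 1's is deleted: in one block it would coincide with the zero column of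
the next. -/
theorem exists_B24_eq_zero (c : Fin 24) : ∃ r, B24 r c = 0 := by
  revert c
  unfold B24 M25
  decide

theorem card_separating_B24_le (r s : Fin 5) : #{c | B24 r c = 1 ∧ B24 s c = 0} ≤ 6 := by
  revert r s
  unfold B24 M25
  decide

theorem isSimple_blockConstruction {ρ κ : Type*} (t : ℕ) {B : Mat01 ρ κ} (hB : IsSimple B)
    (hB0 : ∀ c, ∃ r, B r c = 0) : IsSimple (blockConstruction t B) := by
  have key (j j' : Fin t) (c c' : κ)
      (h : ∀ i, blockConstruction t B i (Sum.inl (j, c)) =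
        blockConstruction t B i (Sum.inl (j', c'))) : j' ≤ j := by
    by_contra! hlt
    obtain ⟨r, hr⟩ := hB0 c
    have := h (j, r)
    simp [blockConstruction, hlt, hr] at this
  rintro (⟨j, c⟩ | ⟨⟩) (⟨j', c'⟩ | ⟨⟩) h
  · obtain rfl : j = j' := le_antisymm (key _ _ _ _ fun i => (h i).symm) (key _ _ _ _ h)
    congr 2
    refine hB c c' fun r => ?_
    simpa [blockConstruction] using h (j, r)
  · obtain ⟨r, hr⟩ := hB0 c
    have := h (j, r)
    simp [blockConstruction, hr] at this
  · obtain ⟨r, hr⟩ := hB0 c'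
    have := h (j', r)
    simp [blockConstruction, hr] at this
  · rfl

theorem not_isConfig_blockConstruction {ρ κ : Type*} [Fintype κ] [DecidableEq κ] (t p : ℕ)
    {B : Mat01 ρ κ} (hB : ∀ r s, #{c | B r c = 1 ∧ B s c = 0} < p) :
    ¬ IsConfig (F0p10 p) (blockConstruction t B) := by
  intro h
  obtain ⟨⟨i, r⟩, ⟨j, s⟩, h7, d, hd0, hd1⟩ := h.exists_rows_F0p10
  -- A row of an earlier block dominates every row of a later block, so such a pair is separated in
  -- one direction only.
  have nested {i j : Fin t} (hij : i < j) (r s : ρ) (y : (Fin t × κ) ⊕ Unit)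
      (h0 : blockConstruction t B (i, r) y = 0) : blockConstruction t B (j, s) y ≠ 1 := by
    rcases y with ⟨l, c⟩ | ⟨⟩
    · have hil : ¬ i < l := fun hil => by simp [blockConstruction, hil] at h0
      have h1 : ¬ j < l := fun hjl => hil (hij.trans hjl)
      have h2 : j ≠ l := fun hjl => hil (hjl ▸ hij)
      simp [blockConstruction, h1, h2]
    · simp [blockConstruction] at h0
  have hp : 0 < p := (Nat.zero_le _).trans_lt (hB r s)
  rcases lt_trichotomy i j with hij | rfl | hij
  · exact nested hij r s d hd0 hd1
  · have hsub : ({c | blockConstruction t B (i, r) c = 1 ∧ blockConstruction t B (i, s) c = 0} :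
        Finset ((Fin t × κ) ⊕ Unit)) ⊆
        ({c | B r c = 1 ∧ B s c = 0} : Finset κ).image fun c => Sum.inl (i, c) := by
      rintro (⟨l, c⟩ | ⟨⟩) hy
      · rw [mem_filter] at hy
        obtain ⟨-, h1, h0⟩ := hy
        rcases lt_trichotomy i l with hl | rfl | hl
        · simp [blockConstruction, hl] at h0
        · simp only [blockConstruction, lt_irrefl, if_false, if_true] at h1 h0
          exact mem_image_of_mem _ (mem_filter.2 ⟨mem_univ c, h1, h0⟩)
        · simp [blockConstruction, hl.not_gt, hl.ne'] at h1
      · simp [blockConstruction] at hy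
    exact (h7.trans ((card_le_card hsub).trans card_image_le)).not_gt (hB r s)
  · obtain ⟨y, hy⟩ := card_pos.1 (hp.trans_le h7)
    rw [mem_filter] at hy
    exact nested hij s r y hy.2.2 hy.2.1

theorem avoids_blockConstruction_B24 (t : ℕ) : Avoids (F0p10 7) (blockConstruction t B24) :=
  ⟨isSimple_blockConstruction t isSimple_B24 exists_B24_eq_zero,
    not_isConfig_blockConstruction t 7 fun r s => Nat.lt_succ_of_le (card_separating_B24_le r s)⟩

theorem forb_F0p10_seven_five_mul (t : ℕ) : forb (5 * t) (F0p10 7) = 24 * t + 1 := by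
  have h1 := (avoids_blockConstruction_B24 t).card_le_forb
  have h2 := forb_F0p10_seven_le (5 * t)
  simp only [Fintype.card_sum, Fintype.card_prod, Fintype.card_fin, Fintype.card_unit,
    mul_comm t] at h1
  omega

end ForbConfig

theorem mainTheorem3 :
    (∀ m : ℕ, ForbConfig.forb m (ForbConfig.F0p10 7) ≤ ⌊(24 / 5 : ℚ) * (m : ℚ)⌋₊ + 1) ∧
    (∀ m : ℕ, m ≡ 0 [MOD 5] →
      ForbConfig.forb m (ForbConfig.F0p10 7) = ⌊(24 / 5 : ℚ) * (m : ℚ)⌋₊ + 1) ∧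
    (∀ t : ℕ, ForbConfig.IsExtremal (ForbConfig.F0p10 7)
      (ForbConfig.blockConstruction t ForbConfig.B24)) := by
  have hfloor (m : ℕ) : ⌊(24 / 5 : ℚ) * (m : ℚ)⌋₊ = 24 * m / 5 := by
    rw [← Nat.floor_div_eq_div (K := ℚ)]
    congr 1
    push_cast
    ring
  refine ⟨fun m => ?_, fun m hm => ?_, fun t => ⟨ForbConfig.avoids_blockConstruction_B24 t, ?_⟩⟩
  · have := ForbConfig.forb_F0p10_seven_le m
    rw [hfloor]
    omega
  · obtain ⟨t, rfl⟩ := Nat.modEq_zero_iff_dvd.1 hm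
    rw [hfloor, ForbConfig.forb_F0p10_seven_five_mul]
    omega
  · simp only [Fintype.card_sum, Fintype.card_prod, Fintype.card_fin, Fintype.card_unit,
      mul_comm t, ForbConfig.forb_F0p10_seven_five_mul]
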